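/- **Theorem 2.2.** Let $A=(a_{ij})\in\mathbb{R}^{n\times n}$ be a nonsingular Z-matrix (that is, $a_{ij}\le 0$ for $i\ne j$) with unit diagonal, $a_{ii}=1$ for all $i$. Let $0\le\gamma\le\omega\le 1$, $\omega\neq 0$, and let $\alpha_{ij}\in[0,1]$ for $1\le i\neq j\le n$. Let $\tilde P=(\tilde p_{ij})$ be the preconditioner with $\tilde p_{ii}=1$ and $\tilde p_{ij}=-\alpha_{ij}a_{ij}$ for $i\ne j$, and put $\tilde A=\tilde P A$. Write $A=I-L-U$ and $\tilde A=\tilde D-\tilde L-\tilde U$, where $\tilde D$ is diagonal, $L,\tilde L$ are strictly lower triangular and $U,\tilde U$ are strictly upper triangular. Define the AOR iteration matrices $$\mathcal{L}_{\gamma,\omega}=(I-\gamma L)^{-1}\big[(1-\omega)I+(\omega-\gamma)L+\omega U\big],\qquad \tilde{\mathcal{L}}_{\gamma,\omega}=(\tilde D-\gamma\tilde L)^{-1}\big[(1-\omega)\tilde D+(\omega-\gamma)\tilde L+\omega\tilde U\big],$$ and let $\rho$ denote the spectral radius (the largest modulus of a complex eigenvalue). If $\rho(\mathcal{L}_{\gamma,\omega})<1$,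 then $\tilde D-\gamma\tilde L$ is nonsingular (so that $\tilde{\mathcal{L}}_{\gamma,\omega}$ is defined) and $$\rho(\tilde{\mathcal{L}}_{\gamma,\omega})\le\rho(\mathcal{L}_{\gamma,\omega})<1.$$ -/

import Mathlib

open scoped ENNReal

namespace AOR

/-- The preconditioner with unit diagonal and off-diagonal entries `-α i j * A i j`.
The diagonal entries of `α` play no role. -/
def preconditioner {n : ℕ} (α A : Matrix (Fin n) (Fin n) ℝ) : Matrix (Fin n) (Fin n) ℝ :=
  Matrix.of fun i j => if i = j then 1 else -(α i j * A i j)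

/-- The diagonal part `D` of the splitting `B = D - L - U`. -/
def diagPart {n : ℕ} (B : Matrix (Fin n) (Fin n) ℝ) : Matrix (Fin n) (Fin n) ℝ :=
  Matrix.of fun i j => if i = j then B i j else 0

/-- The strictly lower triangular `L` of the splitting `B = D - L - U`
(it is minus the strictly lower triangular part of `B`). -/
def lowerPart {n : ℕ} (B : Matrix (Fin n) (Fin n) ℝ) : Matrix (Fin n) (Fin n) ℝ :=
  Matrix.of fun i j => if j < i then -B i j else 0

/-- The strictly upper triangular `U` of the splitting `B = D - L - U`
(it is minus the strictly upper triangular part of `B`). -/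
def upperPart {n : ℕ} (B : Matrix (Fin n) (Fin n) ℝ) : Matrix (Fin n) (Fin n) ℝ :=
  Matrix.of fun i j => if i < j then -B i j else 0

theorem eq_diagPart_sub {n : ℕ} (B : Matrix (Fin n) (Fin n) ℝ) :
    B = diagPart B - lowerPart B - upperPart B := by
  ext i j
  rcases lt_trichotomy i j with h | h | h
  · simp [diagPart, lowerPart, upperPart, h, h.ne, h.not_gt]
  · simp [diagPart, lowerPart, upperPart, h]
  · simp [diagPart, lowerPart, upperPart, h, h.ne', h.not_gt]

/-- For a matrix with unit diagonal the splitting is `A = I - L - U`. -/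
theorem diagPart_eq_one {n : ℕ} (A : Matrix (Fin n) (Fin n) ℝ) (h : ∀ i, A i i = 1) :
    diagPart A = 1 := by
  ext i j
  by_cases hij : i = j
  · subst hij; simp [diagPart, h]
  · simp [diagPart, hij]

/-- The matrix `D - γ L` that the AOR method inverts. -/
def leftMatrix {n : ℕ} (γ : ℝ) (B : Matrix (Fin n) (Fin n) ℝ) : Matrix (Fin n) (Fin n) ℝ :=
  diagPart B - γ • lowerPart B

/-- The AOR iteration matrix `(D - γ L)⁻¹ ((1 - ω) D + (ω - γ) L + ω U)` of `B = D - L - U`;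
it is meaningful when `D - γ L` is nonsingular. -/
noncomputable def iterationMatrix {n : ℕ} (γ ω : ℝ) (B : Matrix (Fin n) (Fin n) ℝ) :
    Matrix (Fin n) (Fin n) ℝ :=
  (leftMatrix γ B)⁻¹ *
    ((1 - ω) • diagPart B + (ω - γ) • lowerPart B + ω • upperPart B)

/-- The spectral radius of a real matrix: the largest modulus of its complex eigenvalues. -/
noncomputable def rho {n : ℕ} (B : Matrix (Fin n) (Fin n) ℝ) : ℝ≥0∞ :=
  spectralRadius ℂ (B.map ((↑) : ℝ → ℂ))

end AOR

/-!
Write `M - N = ω A` and `M' - N' = ω P A` for the two AOR splittings, so that the iteration matrices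
are `T = M⁻¹ N` and `T' = M'⁻¹ N'`. It suffices to bound `ρ(T')` by every `μ` with
`ρ(T) < μ < 1`. Such a `μ` gives a strictly positive vector `x` with `(μ M - N) x = 1`, because
`μ - T` is inverse nonnegative (`exists_resolvent_solution`), and this vector does all the work.

* `ω A x = (1 - μ) M x + 1 > 0`. Since `P` is nonnegative with unit diagonal, `P A x > 0`. As `P A`
  is again a Z-matrix (`preconditioner_mul_offDiag_nonpos`), it is a nonsingular M-matrix, and so is
  `M' ≥ P A`. Hence `M'⁻¹` and `T'` are nonnegative (`nonneg_of_mulVec_nonneg`).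
* `M` and `M'` are lower triangular, and the lower triangular part `P_L` of `P` satisfies
  `P_L M ≥ M'` (`leftMatrix_mul_le_lowerTri_mul`). So `P v ≥ P_L v ≥ M' (M⁻¹ v)` whenever `v ≥ 0`
  and `M⁻¹ v ≥ 0`. With `v = ω A x` and `M⁻¹ v = x - T x` this reads
  `M' (x - T' x) ≥ M' (x - T x)`, whence `T' x ≤ T x ≤ μ x`.

A nonnegative matrix with `T' x ≤ μ x` for some `x > 0` has spectral radius at most `μ`
(`rho_le_of_mulVec_le`). Neither irreducibility nor a Perron vector is involved. Only the
lower triangular part of `P` can be compared: `P M ≥ M'` fails in general above the diagonal.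
-/

open Matrix Filter Topology

namespace AOR

/-! ### Nonnegative matrices and vectors -/

section Monotone

variable {ι : Type*} [Fintype ι]

theorem mulVec_apply_nonneg {B : Matrix ι ι ℝ} (hB : ∀ i j, 0 ≤ B i j) {x : ι → ℝ}
    (hx : ∀ i, 0 ≤ x i) (i : ι) : 0 ≤ (B *ᵥ x) i :=
  Finset.sum_nonneg fun j _ => mul_nonneg (hB i j) (hx j)

theorem mulVec_apply_le_mulVec_apply {B C : Matrix ι ι ℝ} (hBC : ∀ i j, B i j ≤ C i j) {x : ι → ℝ}
    (hx : ∀ i, 0 ≤ x i) (i : ι) : (B *ᵥ x) i ≤ (C *ᵥ x) i :=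
  Finset.sum_le_sum fun j _ => mul_le_mul_of_nonneg_right (hBC i j) (hx j)

/-- A Z-matrix that maps some positive vector to a positive vector is monotone. -/
theorem nonneg_of_mulVec_nonneg {B : Matrix ι ι ℝ} (hZ : ∀ i j, i ≠ j → B i j ≤ 0)
    {x : ι → ℝ} (hx : ∀ i, 0 < x i) (hBx : ∀ i, 0 < (B *ᵥ x) i)
    {y : ι → ℝ} (hy : ∀ i, 0 ≤ (B *ᵥ y) i) (i : ι) : 0 ≤ y i := by
  -- If the smallest ratio `t = y k / x k` were negative, row `k` of `B (y - t x)` would be positive,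
  -- although `y - t x ≥ 0` vanishes at `k`.
  obtain ⟨k, -, hk⟩ := Finset.exists_min_image Finset.univ (fun j => y j / x j)
    ⟨i, Finset.mem_univ i⟩
  set t := y k / x k with ht
  have hle : ∀ j, t * x j ≤ y j := fun j => (le_div_iff₀ (hx j)).1 (hk j (Finset.mem_univ j))
  have hkk : y k = t * x k := by rw [ht, div_mul_cancel₀ _ (hx k).ne']
  by_contra! hi
  have ht0 : t < 0 := (hk i (Finset.mem_univ i)).trans_lt (div_neg_of_neg_of_pos hi (hx i))
  have h1 : (B *ᵥ (y - t • x)) k ≤ 0 := by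
    refine Finset.sum_nonpos fun j _ => ?_
    rcases eq_or_ne k j with rfl | hkj
    · simp [hkk]
    · exact mul_nonpos_of_nonpos_of_nonneg (hZ k j hkj) (by simpa using hle j)
  rw [mulVec_sub, mulVec_smul] at h1
  simp only [Pi.sub_apply, Pi.smul_apply, smul_eq_mul] at h1
  nlinarith [hy k, mul_neg_of_neg_of_pos ht0 (hBx k)]

variable [DecidableEq ι]

theorem isUnit_det_of_mulVec_nonneg {B : Matrix ι ι ℝ}
    (hB : ∀ y : ι → ℝ, (∀ i, 0 ≤ (B *ᵥ y) i) → ∀ i, 0 ≤ y i) : IsUnit B.det := by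
  rw [isUnit_iff_ne_zero]
  intro h
  obtain ⟨v, hv, hBv⟩ := exists_mulVec_eq_zero_iff.2 h
  refine hv (funext fun i => le_antisymm ?_ (hB v (by simp [hBv]) i))
  simpa using hB (-v) (by simp [mulVec_neg, hBv]) i

end Monotone

/-! ### Bounds for the spectral radius -/

variable {n : ℕ}

/-- Collatz–Wielandt upper bound for the spectral radius of a nonnegative matrix. -/
theorem rho_le_of_mulVec_le {B : Matrix (Fin n) (Fin n) ℝ} (hB : ∀ i j, 0 ≤ B i j)
    {x : Fin n → ℝ} (hx : ∀ i, 0 < x i) {μ : ℝ} (hμ : ∀ i, (B *ᵥ x) i ≤ μ * x i) :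
    rho B ≤ ENNReal.ofReal μ := by
  refine iSup₂_le fun z hz => ?_
  change ‖z‖ₑ ≤ _
  rw [← ofReal_norm z]
  refine ENNReal.ofReal_le_ofReal ?_
  rw [← spectrum_toLin', ← Module.End.hasEigenvalue_iff_mem_spectrum] at hz
  obtain ⟨v, hv⟩ := hz.exists_hasEigenvector
  have hev : ∀ i, ∑ j, (B i j : ℂ) * v j = z * v i := fun i => by
    have := congrFun hv.apply_eq_smul i
    simpa [mulVec, dotProduct] using this
  obtain ⟨i₀, hi₀⟩ := Function.ne_iff.1 hv.2
  -- Compare moduli in the row where `|v k| / x k` is largest.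
  obtain ⟨k, -, hk⟩ := Finset.exists_max_image Finset.univ (fun j => ‖v j‖ / x j)
    ⟨i₀, Finset.mem_univ i₀⟩
  set t := ‖v k‖ / x k with ht
  have hle : ∀ j, ‖v j‖ ≤ t * x j := fun j => (div_le_iff₀ (hx j)).1 (hk j (Finset.mem_univ j))
  have hkk : ‖v k‖ = t * x k := by rw [ht, div_mul_cancel₀ _ (hx k).ne']
  have ht0 : 0 < t :=
    (div_pos (norm_pos_iff.2 hi₀) (hx i₀)).trans_le (hk i₀ (Finset.mem_univ i₀))
  have h1 : ‖z‖ * ‖v k‖ ≤ t * (μ * x k) := by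
    rw [← norm_mul, ← hev k]
    calc ‖∑ j, (B k j : ℂ) * v j‖ ≤ ∑ j, B k j * (t * x j) := by
          refine norm_sum_le_of_le _ fun j _ => ?_
          rw [norm_mul, Complex.norm_real, Real.norm_of_nonneg (hB k j)]
          exact mul_le_mul_of_nonneg_left (hle j) (hB k j)
      _ = t * (B *ᵥ x) k := by
          simp only [mulVec, dotProduct, Finset.mul_sum]
          exact Finset.sum_congr rfl fun j _ => by ring
      _ ≤ t * (μ * x k) := mul_le_mul_of_nonneg_left (hμ k) ht0.le
  rw [hkk] at h1
  have : 0 < t * x k := mul_pos ht0 (hx k)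
  nlinarith

section Decay

attribute [local instance] Matrix.linftyOpNormedRing Matrix.linftyOpNormedAlgebra

/-- The powers of `B / μ` tend to zero when `ρ(B) < μ`, by Gelfand's formula. -/
theorem tendsto_inv_pow_mul_pow_mulVec {B : Matrix (Fin n) (Fin n) ℝ} {μ : ℝ}
    (hB : rho B < ENNReal.ofReal μ) (y : Fin n → ℝ) (i : Fin n) :
    Tendsto (fun k : ℕ => μ⁻¹ ^ k * (B ^ k *ᵥ y) i) atTop (𝓝 0) := by
  set C : Matrix (Fin n) (Fin n) ℂ := B.map ((↑) : ℝ → ℂ) with hC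
  obtain ⟨r, hr, hrμ⟩ := ENNReal.lt_iff_exists_nnreal_btwn.1 hB
  rw [ENNReal.ofReal, ENNReal.coe_lt_coe, Real.lt_toNNReal_iff_coe_lt] at hrμ
  have hμ : 0 < μ := r.coe_nonneg.trans_lt hrμ
  have : CompleteSpace (Matrix (Fin n) (Fin n) ℂ) := FiniteDimensional.complete ℂ _
  have hev : ∀ᶠ k : ℕ in atTop, ‖C ^ k‖ ≤ (r : ℝ) ^ k := by
    have h := (spectrum.pow_norm_pow_one_div_tendsto_nhds_spectralRadius C).eventually_lt_const hr
    filter_upwards [h, eventually_gt_atTop 0] with k hk hk0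
    have hk' : ‖C ^ k‖ ^ (1 / k : ℝ) ≤ r := by
      rw [← ENNReal.ofReal_coe_nnreal] at hk
      exact (ENNReal.ofReal_le_ofReal_iff r.coe_nonneg).1 hk.le
    calc ‖C ^ k‖ = (‖C ^ k‖ ^ (1 / k : ℝ)) ^ k := by
          rw [one_div, Real.rpow_inv_natCast_pow (norm_nonneg _) hk0.ne']
      _ ≤ (r : ℝ) ^ k := pow_le_pow_left₀ (by positivity) hk' k
  set w : Fin n → ℂ := fun j => (y j : ℂ) with hw
  have hcast : ∀ k : ℕ, (C ^ k *ᵥ w) i = (((B ^ k *ᵥ y) i : ℝ) : ℂ) := fun k => by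
    have : C ^ k = (B ^ k).map ((↑) : ℝ → ℂ) := (map_pow Complex.ofRealHom.mapMatrix B k).symm
    rw [this]
    simp [mulVec, dotProduct, hw]
  have hlim : Tendsto (fun k : ℕ => ((r : ℝ) / μ) ^ k * ‖w‖) atTop (𝓝 0) := by
    simpa using (tendsto_pow_atTop_nhds_zero_of_lt_one (by positivity)
      ((div_lt_one hμ).2 hrμ)).mul_const ‖w‖
  refine squeeze_zero_norm' ?_ hlim
  filter_upwards [hev] with k hk
  have h1 : ‖(B ^ k *ᵥ y) i‖ ≤ (r : ℝ) ^ k * ‖w‖ := by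
    rw [← Complex.norm_real, ← hcast]
    exact (norm_le_pi_norm _ i).trans ((linfty_opNorm_mulVec _ _).trans (by gcongr))
  rw [norm_mul, norm_pow, norm_inv, Real.norm_of_nonneg hμ.le, div_pow, inv_pow, div_eq_inv_mul,
    mul_assoc]
  gcongr

end Decay

/-- For `B ≥ 0` and `μ > ρ(B)`, the inverse of `μ - B` is at least `μ⁻¹`. -/
theorem exists_resolvent_solution {B : Matrix (Fin n) (Fin n) ℝ} (hB : ∀ i j, 0 ≤ B i j) {μ : ℝ}
    (hμ : 0 < μ) (hρ : rho B < ENNReal.ofReal μ) {b : Fin n → ℝ} (hb : ∀ i, 0 ≤ b i) :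
    ∃ y : Fin n → ℝ, μ • y - B *ᵥ y = b ∧ ∀ i, b i ≤ μ * y i := by
  have hmono : ∀ y : Fin n → ℝ, (∀ i, 0 ≤ ((μ • (1 : Matrix (Fin n) (Fin n) ℝ) - B) *ᵥ y) i) →
      ∀ i, 0 ≤ y i := by
    intro y hy i
    have hy1 : ∀ j, (B *ᵥ y) j ≤ μ * y j := fun j => by
      simpa [sub_mulVec, smul_mulVec] using hy j
    -- `y` dominates every `(B / μ) ^ k y`, and these tend to zero.
    have hk : ∀ k : ℕ, ∀ j, (B ^ k *ᵥ y) j ≤ μ ^ k * y j := by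
      intro k
      induction k with
      | zero => simp
      | succ k ih =>
        intro j
        have h2 : (B *ᵥ (μ ^ k • y - B ^ k *ᵥ y)) j ≥ 0 :=
          mulVec_apply_nonneg hB (fun l => by simpa using ih l) j
        rw [mulVec_sub, mulVec_smul, mulVec_mulVec, ← pow_succ'] at h2
        simp only [Pi.sub_apply, Pi.smul_apply, smul_eq_mul] at h2
        have h3 := mul_le_mul_of_nonneg_left (hy1 j) (pow_nonneg hμ.le k)
        rw [pow_succ μ, mul_assoc]
        linarith
    refine le_of_tendsto' (tendsto_inv_pow_mul_pow_mulVec hρ y i) fun k => ?_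
    rw [inv_pow, inv_mul_le_iff₀ (pow_pos hμ k)]
    exact hk k i
  have hdet := isUnit_det_of_mulVec_nonneg hmono
  set y := (μ • (1 : Matrix (Fin n) (Fin n) ℝ) - B)⁻¹ *ᵥ b with hy
  have hsol : (μ • (1 : Matrix (Fin n) (Fin n) ℝ) - B) *ᵥ y = b := by
    rw [hy, mulVec_mulVec, mul_nonsing_inv _ hdet, one_mulVec]
  have hy0 : ∀ i, 0 ≤ y i := hmono y (by simpa [hsol] using hb)
  have hsol' : μ • y - B *ᵥ y = b := by
    rw [← hsol, sub_mulVec, smul_mulVec, one_mulVec]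
  refine ⟨y, hsol', fun i => ?_⟩
  have h1 := congrFun hsol' i
  simp only [Pi.sub_apply, Pi.smul_apply, smul_eq_mul] at h1
  linarith [mulVec_apply_nonneg hB hy0 i]

/-! ### The AOR splitting -/

/-- The second matrix `(1 - ω) D + (ω - γ) L + ω U` of the AOR splitting of `ω B`. -/
def rightMatrix (γ ω : ℝ) (B : Matrix (Fin n) (Fin n) ℝ) : Matrix (Fin n) (Fin n) ℝ :=
  (1 - ω) • diagPart B + (ω - γ) • lowerPart B + ω • upperPart B

theorem leftMatrix_apply (γ : ℝ) (B : Matrix (Fin n) (Fin n) ℝ) (i j : Fin n) :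
    leftMatrix γ B i j = (if i = j then 1 else if j < i then γ else 0) * B i j := by
  rcases lt_trichotomy i j with h | h | h
  · simp [leftMatrix, diagPart, lowerPart, h.ne, h.not_gt]
  · simp [leftMatrix, diagPart, lowerPart, h]
  · simp [leftMatrix, diagPart, lowerPart, h, h.ne']

theorem rightMatrix_eq (γ ω : ℝ) (B : Matrix (Fin n) (Fin n) ℝ) :
    rightMatrix γ ω B = leftMatrix γ B - ω • B := by
  conv_rhs => rw [eq_diagPart_sub B]
  ext i j
  rcases lt_trichotomy i j with h | h | h
  · simp [rightMatrix, leftMatrix, diagPart, lowerPart, upperPart, h, h.ne, h.not_gt]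
  · simp [rightMatrix, leftMatrix, diagPart, lowerPart, upperPart, h]; ring
  · simp [rightMatrix, leftMatrix, diagPart, lowerPart, upperPart, h, h.ne', h.not_gt]; ring

theorem rightMatrix_nonneg {γ ω : ℝ} {B : Matrix (Fin n) (Fin n) ℝ}
    (hZ : ∀ i j, i ≠ j → B i j ≤ 0) (hd : ∀ i, 0 ≤ B i i) (hγ : 0 ≤ γ) (hγω : γ ≤ ω) (hω : ω ≤ 1)
    (i j : Fin n) : 0 ≤ rightMatrix γ ω B i j := by
  rw [rightMatrix_eq, Matrix.sub_apply, leftMatrix_apply, Matrix.smul_apply, smul_eq_mul]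
  rcases eq_or_ne i j with rfl | h
  · rw [if_pos rfl]; nlinarith [hd i]
  · rw [if_neg h]
    have := hZ i j h
    split_ifs <;> nlinarith

theorem leftMatrix_offDiag_nonpos {γ : ℝ} {B : Matrix (Fin n) (Fin n) ℝ}
    (hZ : ∀ i j, i ≠ j → B i j ≤ 0) (hγ : 0 ≤ γ) (i j : Fin n) (hij : i ≠ j) :
    leftMatrix γ B i j ≤ 0 := by
  rw [leftMatrix_apply]
  exact mul_nonpos_of_nonneg_of_nonpos (by split_ifs <;> simp [hγ]) (hZ i j hij)

theorem le_leftMatrix {γ : ℝ} {B : Matrix (Fin n) (Fin n) ℝ}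
    (hZ : ∀ i j, i ≠ j → B i j ≤ 0) (hγ : γ ≤ 1) (i j : Fin n) : B i j ≤ leftMatrix γ B i j := by
  rw [leftMatrix_apply]
  rcases eq_or_ne i j with rfl | h
  · simp
  · have := hZ i j h
    split_ifs <;> nlinarith

/-- Forward substitution: a lower triangular Z-matrix with unit diagonal is monotone, and its
inverse dominates the identity. -/
theorem leftMatrix_mulVec_le {γ : ℝ} {B : Matrix (Fin n) (Fin n) ℝ}
    (hZ : ∀ i j, i ≠ j → B i j ≤ 0) (hd : ∀ i, B i i = 1) (hγ : 0 ≤ γ) {y : Fin n → ℝ}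
    (hy : ∀ i, 0 ≤ (leftMatrix γ B *ᵥ y) i) (i : Fin n) : (leftMatrix γ B *ᵥ y) i ≤ y i := by
  induction i using WellFoundedLT.induction with
  | ind i ih =>
    have hsum : (leftMatrix γ B *ᵥ y) i =
        y i + ∑ j ∈ Finset.univ.erase i, leftMatrix γ B i j * y j := by
      rw [mulVec, dotProduct, ← Finset.add_sum_erase _ _ (Finset.mem_univ i)]
      simp [leftMatrix_apply, hd]
    rw [hsum]
    refine add_le_of_nonpos_right (Finset.sum_nonpos fun j hj => ?_)
    have hji : j ≠ i := Finset.ne_of_mem_erase hj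
    rcases lt_or_gt_of_ne hji with h | h
    · exact mul_nonpos_of_nonpos_of_nonneg (leftMatrix_offDiag_nonpos hZ hγ i j hji.symm)
        ((hy j).trans (ih j h))
    · simp [leftMatrix_apply, hji.symm, h.not_gt]

theorem iterationMatrix_nonneg {γ ω : ℝ} {B : Matrix (Fin n) (Fin n) ℝ}
    (hZ : ∀ i j, i ≠ j → B i j ≤ 0) (hd : ∀ i, 0 ≤ B i i) (hγ : 0 ≤ γ) (hγω : γ ≤ ω) (hω : ω ≤ 1)
    (hmono : ∀ y : Fin n → ℝ, (∀ i, 0 ≤ (leftMatrix γ B *ᵥ y) i) → ∀ i, 0 ≤ y i)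
    (i j : Fin n) : 0 ≤ iterationMatrix γ ω B i j := by
  -- Column `j` of the iteration matrix solves a system with nonnegative right-hand side.
  refine hmono (fun k => iterationMatrix γ ω B k j) (fun l => ?_) i
  have h : leftMatrix γ B * iterationMatrix γ ω B = rightMatrix γ ω B :=
    mul_nonsing_inv_cancel_left _ _ (isUnit_det_of_mulVec_nonneg hmono)
  have h2 := congrFun (congrFun h l) j
  rw [mul_apply] at h2
  rw [mulVec, dotProduct, h2]
  exact rightMatrix_nonneg hZ hd hγ hγω hω l j

theorem leftMatrix_mulVec_iterationMatrix_mulVec {γ ω : ℝ} {B : Matrix (Fin n) (Fin n) ℝ}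
    (hdet : IsUnit (leftMatrix γ B).det) (x : Fin n → ℝ) :
    leftMatrix γ B *ᵥ (iterationMatrix γ ω B *ᵥ x) = leftMatrix γ B *ᵥ x - ω • (B *ᵥ x) := by
  have h : leftMatrix γ B * iterationMatrix γ ω B = rightMatrix γ ω B :=
    mul_nonsing_inv_cancel_left _ _ hdet
  rw [mulVec_mulVec, h, rightMatrix_eq, sub_mulVec, smul_mulVec]

/-! ### The preconditioned matrix -/

section Preconditioned

variable {A α : Matrix (Fin n) (Fin n) ℝ}

theorem preconditioner_nonneg (hZ : ∀ i j, i ≠ j → A i j ≤ 0)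
    (hα : ∀ i j, i ≠ j → 0 ≤ α i j ∧ α i j ≤ 1) (i j : Fin n) : 0 ≤ preconditioner α A i j := by
  rcases eq_or_ne i j with h | h
  · simp [preconditioner, h]
  · simpa [preconditioner, h] using mul_nonpos_of_nonneg_of_nonpos (hα i j h).1 (hZ i j h)

theorem preconditioner_self (i : Fin n) : preconditioner α A i i = 1 := by
  simp [preconditioner]

theorem le_preconditioner_mulVec (hZ : ∀ i j, i ≠ j → A i j ≤ 0)
    (hα : ∀ i j, i ≠ j → 0 ≤ α i j ∧ α i j ≤ 1) {v : Fin n → ℝ} (hv : ∀ i, 0 ≤ v i) (i : Fin n) :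
    v i ≤ (preconditioner α A *ᵥ v) i := by
  have h := Finset.single_le_sum (f := fun j => preconditioner α A i j * v j)
    (fun j _ => mul_nonneg (preconditioner_nonneg hZ hα i j) (hv j)) (Finset.mem_univ i)
  simpa [preconditioner_self, mulVec, dotProduct] using h

theorem preconditioner_mul_offDiag_nonpos (hdiag : ∀ i, A i i = 1)
    (hZ : ∀ i j, i ≠ j → A i j ≤ 0) (hα : ∀ i j, i ≠ j → 0 ≤ α i j ∧ α i j ≤ 1)
    (i j : Fin n) (hij : i ≠ j) : (preconditioner α A * A) i j ≤ 0 := by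
  rw [mul_apply, ← Finset.add_sum_erase _ _ (Finset.mem_univ i),
    ← Finset.add_sum_erase _ _ (Finset.mem_erase.2 ⟨hij.symm, Finset.mem_univ j⟩), ← add_assoc]
  refine add_nonpos ?_ (Finset.sum_nonpos fun k hk => ?_)
  · -- The terms `k = i` and `k = j` combine to `(1 - α i j) * A i j`.
    simp only [preconditioner, of_apply, if_pos, if_neg hij, hdiag]
    nlinarith [hα i j hij, hZ i j hij]
  · exact mul_nonpos_of_nonneg_of_nonpos (preconditioner_nonneg hZ hα i k)
      (hZ k j (Finset.ne_of_mem_erase hk))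

/-- The lower triangular part, with the diagonal, of a matrix. -/
def lowerTri (B : Matrix (Fin n) (Fin n) ℝ) : Matrix (Fin n) (Fin n) ℝ :=
  Matrix.of fun i j => if j ≤ i then B i j else 0

/-- The entries above the diagonal vanish on both sides. This is what is lost when `lowerTri` is
dropped. -/
theorem leftMatrix_mul_le_lowerTri_mul {γ : ℝ} (hdiag : ∀ i, A i i = 1)
    (hZ : ∀ i j, i ≠ j → A i j ≤ 0) (hα : ∀ i j, i ≠ j → 0 ≤ α i j ∧ α i j ≤ 1)
    (hγ : 0 ≤ γ) (hγ1 : γ ≤ 1) (i j : Fin n) :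
    leftMatrix γ (preconditioner α A * A) i j ≤
      (lowerTri (preconditioner α A) * leftMatrix γ A) i j := by
  rw [leftMatrix_apply, mul_apply, mul_apply, Finset.mul_sum]
  refine Finset.sum_le_sum fun k _ => ?_
  have hP := preconditioner_nonneg hZ hα i k
  have hPA : k ≠ j → preconditioner α A i k * A k j ≤ 0 := fun h =>
    mul_nonpos_of_nonneg_of_nonpos hP (hZ k j h)
  simp only [lowerTri, of_apply, leftMatrix_apply]
  rcases lt_trichotomy i j with hij | rfl | hij
  · rw [if_neg hij.ne, if_neg hij.not_gt, zero_mul]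
    split_ifs with h1 h2 h3
    · exact absurd (h2 ▸ h1) hij.not_ge
    · exact absurd (h3.trans_le h1) hij.not_gt
    all_goals simp
  · rw [if_pos rfl, one_mul]
    rcases lt_trichotomy k i with hk | rfl | hk
    · simpa [hk.le, hk.ne, hk.not_gt] using hPA hk.ne
    · simp
    · simpa [hk.not_ge] using hPA hk.ne'
  · rw [if_neg hij.ne', if_pos hij]
    rcases lt_trichotomy k j with hk | rfl | hk
    · simpa [hk.ne, hk.not_gt] using mul_nonpos_of_nonneg_of_nonpos hγ (hPA hk.ne)
    · simp only [hij.le, hdiag, if_true]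
      nlinarith
    · by_cases hki : k ≤ i
      · simp only [hki, hk, hk.ne', if_true, if_false]
        exact le_of_eq (by ring)
      · simpa [hki] using mul_nonpos_of_nonneg_of_nonpos hγ (hPA hk.ne')

theorem leftMatrix_mul_mulVec_le {γ : ℝ} (hdiag : ∀ i, A i i = 1)
    (hZ : ∀ i j, i ≠ j → A i j ≤ 0) (hα : ∀ i j, i ≠ j → 0 ≤ α i j ∧ α i j ≤ 1)
    (hγ : 0 ≤ γ) (hγ1 : γ ≤ 1) {w : Fin n → ℝ} (hw : ∀ i, 0 ≤ w i)
    (hMw : ∀ i, 0 ≤ (leftMatrix γ A *ᵥ w) i) (i : Fin n) :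
    (leftMatrix γ (preconditioner α A * A) *ᵥ w) i ≤
      (preconditioner α A *ᵥ (leftMatrix γ A *ᵥ w)) i := by
  refine (mulVec_apply_le_mulVec_apply
    (leftMatrix_mul_le_lowerTri_mul hdiag hZ hα hγ hγ1) hw i).trans ?_
  rw [← mulVec_mulVec]
  refine mulVec_apply_le_mulVec_apply (fun k l => ?_) hMw i
  simp only [lowerTri, of_apply]
  split_ifs
  · exact le_rfl
  · exact preconditioner_nonneg hZ hα k l

/-- The comparison for a single `μ` strictly between `ρ(T)` and `1`. -/
theorem isUnit_det_and_rho_le {γ ω μ : ℝ} (hdiag : ∀ i, A i i = 1)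
    (hZ : ∀ i j, i ≠ j → A i j ≤ 0) (hα : ∀ i j, i ≠ j → 0 ≤ α i j ∧ α i j ≤ 1)
    (hγ : 0 ≤ γ) (hγω : γ ≤ ω) (hω : ω ≤ 1) (hω0 : 0 < ω) (hμ : 0 < μ) (hμ1 : μ < 1)
    (hρ : rho (iterationMatrix γ ω A) < ENNReal.ofReal μ) :
    IsUnit (leftMatrix γ (preconditioner α A * A)).det ∧
      rho (iterationMatrix γ ω (preconditioner α A * A)) ≤ ENNReal.ofReal μ := by
  set B := preconditioner α A * A with hB
  set M := leftMatrix γ A with hM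
  set M' := leftMatrix γ B with hM'
  set T := iterationMatrix γ ω A with hT
  set T' := iterationMatrix γ ω B with hT'
  have hγ1 : γ ≤ 1 := hγω.trans hω
  have hMle : ∀ y : Fin n → ℝ, (∀ i, 0 ≤ (M *ᵥ y) i) → ∀ i, (M *ᵥ y) i ≤ y i :=
    fun y hy => leftMatrix_mulVec_le hZ hdiag hγ hy
  have hMmono : ∀ y : Fin n → ℝ, (∀ i, 0 ≤ (M *ᵥ y) i) → ∀ i, 0 ≤ y i :=
    fun y hy i => (hy i).trans (hMle y hy i)
  have hMdet : IsUnit M.det := isUnit_det_of_mulVec_nonneg hMmono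
  have hT0 : ∀ i j, 0 ≤ T i j :=
    iterationMatrix_nonneg hZ (fun i => by simp [hdiag]) hγ hγω hω hMmono
  -- The test vector `x = (μ - T)⁻¹ b` with `b = M⁻¹ 1`, that is, `(μ M - N) x = 1`.
  set b : Fin n → ℝ := M⁻¹ *ᵥ 1 with hb
  have hMb : M *ᵥ b = 1 := by rw [hb, mulVec_mulVec, mul_nonsing_inv _ hMdet, one_mulVec]
  have hb1 : ∀ i, 1 ≤ b i := fun i => by
    have := hMle b (by simp [hMb]) i
    simpa [hMb] using this
  obtain ⟨x, hx, hbx⟩ :=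
    exists_resolvent_solution hT0 hμ hρ (fun i => zero_le_one.trans (hb1 i))
  have hx0 : ∀ i, 0 < x i := fun i =>
    pos_of_mul_pos_right (zero_lt_one.trans_le ((hb1 i).trans (hbx i))) hμ.le
  have hN : ∀ i, 0 ≤ (rightMatrix γ ω A *ᵥ x) i :=
    mulVec_apply_nonneg (rightMatrix_nonneg hZ (fun i => by simp [hdiag]) hγ hγω hω)
      fun i => (hx0 i).le
  have hMTx : M *ᵥ (T *ᵥ x) = M *ᵥ x - ω • (A *ᵥ x) :=
    leftMatrix_mulVec_iterationMatrix_mulVec hMdet x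
  have hMx : ∀ i, μ * (M *ᵥ x) i - (M *ᵥ (T *ᵥ x)) i = 1 := fun i => by
    have h := congrFun (congrArg (M *ᵥ ·) hx) i
    simpa [mulVec_sub, mulVec_smul, hMb] using h
  have hMx0 : ∀ i, 0 < (M *ᵥ x) i := fun i => by
    have h1 := hN i
    rw [rightMatrix_eq, sub_mulVec, smul_mulVec, ← hM, ← hMTx] at h1
    exact pos_of_mul_pos_right (by linarith [hMx i]) hμ.le
  have hAx : ∀ i, 0 < (A *ᵥ x) i := fun i => by
    have h1 := hMx i
    rw [hMTx] at h1
    simp only [Pi.sub_apply, Pi.smul_apply, smul_eq_mul] at h1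
    exact pos_of_mul_pos_right (by nlinarith [hMx0 i]) hω0.le
  have hBx : ∀ i, 0 < (B *ᵥ x) i := fun i => by
    rw [hB, ← mulVec_mulVec]
    exact (hAx i).trans_le (le_preconditioner_mulVec hZ hα (fun j => (hAx j).le) i)
  -- The preconditioned matrix and its left matrix are nonsingular M-matrices.
  have hBZ : ∀ i j, i ≠ j → B i j ≤ 0 := preconditioner_mul_offDiag_nonpos hdiag hZ hα
  have hBd : ∀ i, 0 ≤ B i i := fun i => by
    have h1 := hBx i
    rw [mulVec, dotProduct, ← Finset.add_sum_erase _ _ (Finset.mem_univ i)] at h1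
    have h2 : ∑ j ∈ Finset.univ.erase i, B i j * x j ≤ 0 := Finset.sum_nonpos fun j hj =>
      mul_nonpos_of_nonpos_of_nonneg (hBZ i j (Finset.ne_of_mem_erase hj).symm) (hx0 j).le
    exact (pos_of_mul_pos_left (by linarith) (hx0 i).le).le
  have hM'mono : ∀ y : Fin n → ℝ, (∀ i, 0 ≤ (M' *ᵥ y) i) → ∀ i, 0 ≤ y i := fun y hy =>
    nonneg_of_mulVec_nonneg (leftMatrix_offDiag_nonpos hBZ hγ) hx0
      (fun i => (hBx i).trans_le
        (mulVec_apply_le_mulVec_apply (le_leftMatrix hBZ hγ1) (fun j => (hx0 j).le) i)) hy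
  have hM'det : IsUnit M'.det := isUnit_det_of_mulVec_nonneg hM'mono
  have hT'0 : ∀ i j, 0 ≤ T' i j := iterationMatrix_nonneg hBZ hBd hγ hγω hω hM'mono
  refine ⟨hM'det, rho_le_of_mulVec_le hT'0 hx0 fun i => ?_⟩
  -- Compare `T' x` with `T x` through `w = x - T x`, for which `M w = ω A x ≥ 0`.
  have hMw : M *ᵥ (x - T *ᵥ x) = ω • (A *ᵥ x) := by rw [mulVec_sub, hMTx, sub_sub_cancel]
  have hMw0 : ∀ i, 0 ≤ (M *ᵥ (x - T *ᵥ x)) i := fun i => by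
    rw [hMw]; exact mul_nonneg hω0.le (hAx i).le
  have hcomp := leftMatrix_mul_mulVec_le hdiag hZ hα hγ hγ1 (hMmono _ hMw0) hMw0
  have hM'T' : M' *ᵥ (T' *ᵥ x) = M' *ᵥ x - ω • (B *ᵥ x) :=
    leftMatrix_mulVec_iterationMatrix_mulVec hM'det x
  have hle : (T' *ᵥ x) i ≤ (T *ᵥ x) i := by
    refine sub_nonneg.1 (hM'mono (T *ᵥ x - T' *ᵥ x) (fun j => ?_) i)
    have h1 := hcomp j
    rw [← hM, hMw, mulVec_smul, mulVec_mulVec, ← hB, ← hM', mulVec_sub] at h1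
    rw [mulVec_sub, hM'T']
    simp only [Pi.sub_apply] at h1 ⊢
    linarith
  have h2 := congrFun hx i
  simp only [Pi.sub_apply, Pi.smul_apply, smul_eq_mul] at h2
  linarith [hb1 i]

end Preconditioned

end AOR

theorem theorem2p2 (n : ℕ) (A α : Matrix (Fin n) (Fin n) ℝ) (γ ω : ℝ)
    (hdiag : ∀ i, A i i = 1)
    (hZ : ∀ i j, i ≠ j → A i j ≤ 0)
    (hA : IsUnit A.det)
    (hγ : 0 ≤ γ) (hγω : γ ≤ ω) (hω : ω ≤ 1) (hω0 : ω ≠ 0)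
    (hα : ∀ i j, i ≠ j → 0 ≤ α i j ∧ α i j ≤ 1)
    (hρ : AOR.rho (AOR.iterationMatrix γ ω A) < 1) :
    IsUnit (AOR.leftMatrix γ (AOR.preconditioner α A * A)).det ∧
      AOR.rho (AOR.iterationMatrix γ ω (AOR.preconditioner α A * A)) ≤
        AOR.rho (AOR.iterationMatrix γ ω A) ∧
      AOR.rho (AOR.iterationMatrix γ ω A) < 1 := by
  have key : ∀ m : ℝ≥0∞, AOR.rho (AOR.iterationMatrix γ ω A) < m → m < 1 →
      IsUnit (AOR.leftMatrix γ (AOR.preconditioner α A * A)).det ∧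
        AOR.rho (AOR.iterationMatrix γ ω (AOR.preconditioner α A * A)) ≤ m := by
    intro m hm hm1
    have hm_eq : ENNReal.ofReal m.toReal = m := ENNReal.ofReal_toReal (hm1.trans_le le_top).ne
    have hm0 : 0 < m.toReal :=
      ENNReal.toReal_pos (bot_le.trans_lt hm).ne' (hm1.trans_le le_top).ne
    have hm1' : m.toReal < 1 := by
      rwa [← hm_eq, ENNReal.ofReal_lt_one] at hm1
    have h := AOR.isUnit_det_and_rho_le hdiag hZ hα hγ hγω hω
      (lt_of_le_of_ne (hγ.trans hγω) hω0.symm) hm0 hm1' (by rwa [hm_eq])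
    rwa [hm_eq] at h
  refine ⟨?_, ?_, hρ⟩
  · obtain ⟨m, hm, hm1⟩ := exists_between hρ
    exact (key m hm hm1).1
  · by_contra! hlt
    obtain ⟨m, hm, hm'⟩ := exists_between (lt_min hlt hρ)
    exact ((key m hm (hm'.trans_le (min_le_right _ _))).2.trans_lt
      (hm'.trans_le (min_le_left _ _))).false
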